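/- Let $\mathbb{T} = \mathbb{R} \cup \{-\infty\}$ be the max-plus semifield, with addition $x \oplus y = \max(x,y)$ and multiplication $x \odot y = x + y$ (where $-\infty$ is absorbing), extended to matrices and vectors in the usual way. Let $n \geq 1$, and let $M^- \in \mathbb{T}^{n \times n}$ and $q^+ \in \mathbb{T}^n$ be such that no column of $M^-$ is the all-$(-\infty)$ vector and $q^+$ has no entry equal to $-\infty$. The tropical Nash equilibrium complementarity problem (TNECP) asks for vectors $w, z \in \mathbb{T}^n$ such that \[ w \oplus M^- \odot z = q^+, \qquad w^{\top} \odot z = -\infty, \qquad z \neq -\infty , \] where $-\infty$ in the last condition is the all-$(-\infty)$ vector. **Theorem.** The problem (TNECP) always admits a solution, and such a solution can be computed in polynomial time. That is, there is a single algorithm which, given any $n \geq 1$ and any instance $(M^-, q^+)$ as above with entries in $\mathbb{Q} \cup \{-\infty\}$ (rational numbers being encoded by their numerator and denominator in binary), outputs a solution $(w,z)$ with entries in $\mathbb{Q} \cup \{-\infty\}$, in a time polynomial in the bit length of the instance (on a random access machine with the logarithmic cost criterion). -/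

import Mathlib

/-! ### The max-plus semifield and the complementarity problem

For a linearly ordered additive group `R` (here `ℝ` or `ℚ`), `WithBot R` is `R ∪ {-∞}` with
`-∞ = ⊥`. The tropical addition is `⊔` (maximum), the tropical multiplication is `+`, for which
`⊥` is absorbing. -/

namespace TNECP

section Problem

variable {R : Type} [LinearOrder R] [Add R] {n : ℕ}

/-- Tropical matrix-vector product: `(M ⊙ z) i = max_j (M i j + z j)`. -/
def mulVec (M : Matrix (Fin n) (Fin n) (WithBot R)) (z : Fin n → WithBot R) :
    Fin n → WithBot R :=
  fun i => Finset.univ.sup fun j => M i j + z j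

/-- Tropical scalar product: `wᵀ ⊙ z = max_j (w j + z j)`. -/
def dot (w z : Fin n → WithBot R) : WithBot R :=
  Finset.univ.sup fun j => w j + z j

/-- The standing assumptions on an instance `(M, q)`: no column of `M` is the `-∞` vector, and
`q` has no `-∞` entry. -/
structure IsInstance (M : Matrix (Fin n) (Fin n) (WithBot R)) (q : Fin n → WithBot R) : Prop where
  col_ne_bot : ∀ j, (fun i => M i j) ≠ ⊥
  ne_bot : ∀ i, q i ≠ ⊥

/-- `(w, z)` solves `w ⊕ M ⊙ z = q`, `wᵀ ⊙ z = -∞`, `z ≠ -∞`. -/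
structure IsSolution (M : Matrix (Fin n) (Fin n) (WithBot R)) (q w z : Fin n → WithBot R) :
    Prop where
  feasible : w ⊔ mulVec M z = q
  complementary : dot w z = ⊥
  nontrivial : z ≠ ⊥

end Problem

end TNECP

/-! ### Random access machines with logarithmic cost

A machine has integer registers and integer memory banks with random (indirect) access. A program
is a finite command built from assignments, stores, sequencing, conditionals and loops, so it names
only finitely many registers and banks. Every constant, register content, memory content and
intermediate result that occurs in a computation is charged its bit length; this is the usual
logarithmic cost criterion, which is polynomially equivalent to the running time of Turing
machines. -/

namespace RAM

/-- The number of bits used to write down an integer (with one bit for the sign). -/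
def bitLen (a : ℤ) : ℕ := a.natAbs.size + 1

/-- A configuration of the data: `reg x` is the content of register `x`, and `mem k a` is the
content of the cell with address `a` of memory bank `k`. -/
structure State where
  reg : ℕ → ℤ
  mem : ℕ → ℤ → ℤ

/-- Integer expressions. -/
inductive Expr : Type
  | const (c : ℤ)
  | reg (x : ℕ)
  | load (k : ℕ) (addr : Expr)
  | add (e₁ e₂ : Expr)
  | sub (e₁ e₂ : Expr)
  | mul (e₁ e₂ : Expr)

/-- The value of an expression. -/
def Expr.eval (s : State) : Expr → ℤ
  | .const c => c
  | .reg x => s.reg x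
  | .load k addr => s.mem k (addr.eval s)
  | .add e₁ e₂ => e₁.eval s + e₂.eval s
  | .sub e₁ e₂ => e₁.eval s - e₂.eval s
  | .mul e₁ e₂ => e₁.eval s * e₂.eval s

/-- The logarithmic cost of evaluating an expression: the sum of the bit lengths of the values of
all its subexpressions, itself included. -/
def Expr.cost (s : State) : Expr → ℕ
  | .const c => bitLen c
  | .reg x => bitLen (s.reg x)
  | .load k addr => addr.cost s + bitLen ((Expr.load k addr).eval s)
  | .add e₁ e₂ => e₁.cost s + e₂.cost s + bitLen ((Expr.add e₁ e₂).eval s)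
  | .sub e₁ e₂ => e₁.cost s + e₂.cost s + bitLen ((Expr.sub e₁ e₂).eval s)
  | .mul e₁ e₂ => e₁.cost s + e₂.cost s + bitLen ((Expr.mul e₁ e₂).eval s)

/-- Programs. A test `e` succeeds if the value of `e` is positive. -/
inductive Prog : Type
  | skip
  | assign (x : ℕ) (e : Expr)
  | store (k : ℕ) (addr e : Expr)
  | seq (p₁ p₂ : Prog)
  | ite (e : Expr) (p₁ p₂ : Prog)
  | loop (e : Expr) (p : Prog)

/-- Write `v` into register `x`. -/
def State.setReg (s : State) (x : ℕ) (v : ℤ) : State :=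
  { s with reg := Function.update s.reg x v }

/-- Write `v` into the cell with address `a` of memory bank `k`. -/
def State.setMem (s : State) (k : ℕ) (a v : ℤ) : State :=
  { s with mem := Function.update s.mem k (Function.update (s.mem k) a v) }

/-- `Exec p s s' t`: started in state `s`, the program `p` halts in state `s'` after time `t`.
Every executed command and every test takes time one plus the cost of its expressions. -/
inductive Exec : Prog → State → State → ℕ → Prop
  | skip (s : State) : Exec .skip s s 1
  | assign (s : State) (x : ℕ) (e : Expr) :
      Exec (.assign x e) s (s.setReg x (e.eval s)) (1 + e.cost s)
  | store (s : State) (k : ℕ) (addr e : Expr) :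
      Exec (.store k addr e) s (s.setMem k (addr.eval s) (e.eval s))
        (1 + addr.cost s + e.cost s)
  | seq {p₁ p₂ : Prog} {s s' s'' : State} {t₁ t₂ : ℕ} :
      Exec p₁ s s' t₁ → Exec p₂ s' s'' t₂ → Exec (.seq p₁ p₂) s s'' (t₁ + t₂)
  | ite_true {e : Expr} {p₁ p₂ : Prog} {s s' : State} {t : ℕ} :
      0 < e.eval s → Exec p₁ s s' t → Exec (.ite e p₁ p₂) s s' (1 + e.cost s + t)
  | ite_false {e : Expr} {p₁ p₂ : Prog} {s s' : State} {t : ℕ} :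
      e.eval s ≤ 0 → Exec p₂ s s' t → Exec (.ite e p₁ p₂) s s' (1 + e.cost s + t)
  | loop_true {e : Expr} {p : Prog} {s s' s'' : State} {t₁ t₂ : ℕ} :
      0 < e.eval s → Exec p s s' t₁ → Exec (.loop e p) s' s'' t₂ →
        Exec (.loop e p) s s'' (1 + e.cost s + t₁ + t₂)
  | loop_false {e : Expr} {p : Prog} {s : State} :
      e.eval s ≤ 0 → Exec (.loop e p) s s (1 + e.cost s)

end RAM

/-! ### Input and output of rational instances

An element of `ℚ ∪ {-∞}` is written as a pair of integers: a rational number as its numerator and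
denominator in lowest terms, and `-∞` as the pair `(-1, 0)`. -/

namespace TNECP

section Coding

/-- First integer of the code of an element of `ℚ ∪ {-∞}`. -/
def codeNum : WithBot ℚ → ℤ
  | ⊥ => -1
  | (r : ℚ) => r.num

/-- Second integer of the code of an element of `ℚ ∪ {-∞}`. -/
def codeDen : WithBot ℚ → ℤ
  | ⊥ => 0
  | (r : ℚ) => r.den

/-- The element of `ℚ ∪ {-∞}` denoted by a pair of integers (fractions in an output need not be
in lowest terms). -/
def decode (a b : ℤ) : WithBot ℚ :=
  if b = 0 then ⊥ else (((a : ℚ) / (b : ℚ) : ℚ) : WithBot ℚ)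

/-- The code of an element of `ℚ ∪ {-∞}` denotes this element. -/
theorem decode_code (x : WithBot ℚ) : decode (codeNum x) (codeDen x) = x := by
  induction x using WithBot.recBotCoe with
  | bot => simp [decode, codeDen]
  | coe r =>
    simp [decode, codeNum, codeDen, Rat.num_div_den]

variable {n : ℕ}

/-- The bit length of the code of an element of `ℚ ∪ {-∞}`. -/
def codeLen (x : WithBot ℚ) : ℕ := RAM.bitLen (codeNum x) + RAM.bitLen (codeDen x)

/-- The bit length of an instance: that of the dimension and of all entries. -/
def inputSize (M : Matrix (Fin n) (Fin n) (WithBot ℚ)) (q : Fin n → WithBot ℚ) : ℕ :=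
  RAM.bitLen (n : ℤ) + (∑ i, ∑ j, codeLen (M i j)) + ∑ i, codeLen (q i)

/-- `a` is the array `v 0, …, v (m - 1)`, followed and preceded by zeros. -/
def array {m : ℕ} (v : Fin m → ℤ) : ℤ → ℤ :=
  fun a => if h : 0 ≤ a ∧ a.toNat < m then v ⟨a.toNat, h.2⟩ else 0

/-- Row-major listing of a square matrix. -/
def flatten (A : Fin n → Fin n → ℤ) : Fin (n * n) → ℤ :=
  fun k => A k.divNat k.modNat

/-- The initial state for an instance: register `0` holds the dimension `n`; banks `0` and `1`
hold the codes of the entries of `M` (row by row); banks `2` and `3` hold the codes of the entries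
of `q`. Everything else is zero. -/
def input (M : Matrix (Fin n) (Fin n) (WithBot ℚ)) (q : Fin n → WithBot ℚ) : RAM.State where
  reg := fun x => if x = 0 then (n : ℤ) else 0
  mem := fun k =>
    match k with
    | 0 => array (flatten fun i j => codeNum (M i j))
    | 1 => array (flatten fun i j => codeDen (M i j))
    | 2 => array fun i => codeNum (q i)
    | 3 => array fun i => codeDen (q i)
    | _ => fun _ => 0

/-- The vector `w` that a final state contains: its codes are in banks `4` and `5`. -/
def outputW (n : ℕ) (s : RAM.State) : Fin n → WithBot ℚ :=
  fun i => decode (s.mem 4 (i : ℕ)) (s.mem 5 (i : ℕ))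

/-- The vector `z` that a final state contains: its codes are in banks `6` and `7`. -/
def outputZ (n : ℕ) (s : RAM.State) : Fin n → WithBot ℚ :=
  fun i => decode (s.mem 6 (i : ℕ)) (s.mem 7 (i : ℕ))

end Coding

end TNECP

/-! ### Solutions from cycles of a best response map -/

namespace TNECP

/-! Column `j` has a best response: a row `f j` where `M i j - q i` is largest. With `v j` the
negative of that maximum, `v j` added to column `j` stays below `q` and touches it in row `f j`. Let
`S` be a cycle of `f`, put `z = v` on `S` and `w = q` off `S`, and `-∞` elsewhere. The supports are
disjoint, `M ⊙ z ≤ q`, and each row of `S` is the best response to some column of `S`, so equality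
holds there; off `S`, `w` supplies it (`isSolution_of_support`).

A cycle is found by walking `2 * n` steps from column `0`: the columns visited at times `n, …, 2 * n
- 1` form one, the property needed being that each has a predecessor among them
(`exists_iterate_predecessor`).

Each step of the walk is a maximum over `n` fractions, compared by cross-multiplication. No stored
number is built from earlier comparisons: each is, up to sign, a small expression in the input or a
counter, so all contents keep bit length at most `4 * L` for inputs of size `L`. The program thus
executes `O(n ^ 2)` commands, each of cost `O(L)`. -/

theorem exists_iterate_predecessor {α : Type*} {f : α → α} {s : Finset α} {a : α} {n : ℕ}
    (hf : ∀ x ∈ s, f x ∈ s) (ha : a ∈ s) (hs : s.card ≤ n) {x : α}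
    (hx : ∃ u, n ≤ u ∧ u < 2 * n ∧ f^[u] a = x) :
    ∃ y, (∃ u, n ≤ u ∧ u < 2 * n ∧ f^[u] a = y) ∧ f y = x := by
  obtain ⟨u, hnu, hu, rfl⟩ := hx
  have hit : ∀ k, f^[k] a ∈ s := by
    intro k
    induction k with
    | zero => exact ha
    | succ k ih => rw [Function.iterate_succ_apply']; exact hf _ ih
  rcases hnu.lt_or_eq with h | rfl
  · refine ⟨f^[u - 1] a, ⟨u - 1, by omega, by omega, rfl⟩, ?_⟩
    rw [← Function.iterate_succ_apply' f, Nat.succ_eq_add_one, Nat.sub_add_cancel (by omega)]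
  · obtain ⟨i, hi, j, hj, hij, he⟩ : ∃ i ∈ Finset.range (n + 1), ∃ j ∈ Finset.range (n + 1),
        i ≠ j ∧ f^[i] a = f^[j] a :=
      Finset.exists_ne_map_eq_of_card_lt_of_maps_to (t := s)
        (by rw [Finset.card_range]; omega) (fun k _ => hit k)
    wlog hlt : i < j generalizing i j
    · exact this j hj i hi hij.symm he.symm (by omega)
    rw [Finset.mem_range] at hi hj
    -- Times `i < j ≤ n` carry the same point, so from time `i` on the orbit has period `j - i`.
    -- Hence time `n` repeats at `n + (j - i) ≤ 2 * n`, and the time just before lies in the window.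
    refine ⟨f^[n + (j - i) - 1] a, ⟨n + (j - i) - 1, by omega, by omega, rfl⟩, ?_⟩
    rw [← Function.iterate_succ_apply' f, Nat.succ_eq_add_one, Nat.sub_add_cancel (by omega),
      show n + (j - i) = (n - i) + j by omega, Function.iterate_add_apply, ← he,
      ← Function.iterate_add_apply, Nat.sub_add_cancel (by omega)]

section

variable {R : Type} [LinearOrder R] [Add R] {n : ℕ}

/-- Complementarity holds because `w` and `z` have disjoint supports. Over a general `R` this serves
both the real existence statement and the rational output of the program. -/
theorem isSolution_of_support {M : Matrix (Fin n) (Fin n) (WithBot R)} {q : Fin n → WithBot R}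
    (S : Fin n → Prop) [DecidablePred S] (v : Fin n → R)
    (hle : ∀ j, S j → ∀ i, M i j + v j ≤ q i)
    (heq : ∀ i, S i → ∃ j, S j ∧ M i j + v j = q i) (hne : ∃ j, S j) :
    IsSolution M q (fun i => if S i then ⊥ else q i)
      (fun j => if S j then (v j : WithBot R) else ⊥) where
  feasible := by
    have hmul : ∀ i, mulVec M (fun j => if S j then (v j : WithBot R) else ⊥) i ≤ q i := by
      intro i
      refine Finset.sup_le fun j _ => ?_
      by_cases hj : S j
      · simpa [hj] using hle j hj i
      · simp [hj]
    funext i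
    rw [Pi.sup_apply]
    by_cases hi : S i
    · obtain ⟨j, hj, h⟩ := heq i hi
      rw [if_pos hi, bot_sup_eq]
      refine le_antisymm (hmul i) ?_
      rw [← h]
      have := Finset.le_sup
        (f := fun j => M i j + (if S j then (v j : WithBot R) else ⊥)) (Finset.mem_univ j)
      simp only [if_pos hj] at this
      exact this
    · rw [if_neg hi]
      exact sup_eq_left.2 (hmul i)
  complementary := by
    refine (Finset.sup_eq_bot_iff _ _).2 fun j _ => ?_
    by_cases hj : S j <;> simp [hj]
  nontrivial := by
    obtain ⟨j, hj⟩ := hne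
    intro h
    have := congrFun h j
    simp [hj] at this

end

theorem exists_best_response {R : Type} [LinearOrder R] [AddCommGroup R] [IsOrderedAddMonoid R]
    {n : ℕ} {M : Matrix (Fin n) (Fin n) (WithBot R)} {q : Fin n → WithBot R}
    (h : IsInstance M q) (j : Fin n) :
    ∃ (i : Fin n) (v : R), M i j + v = q i ∧ ∀ k, M k j + v ≤ q k := by
  classical
  choose r hr using fun i => WithBot.ne_bot_iff_exists.1 (h.ne_bot i)
  have hcol : ∃ i, M i j ≠ ⊥ := by
    by_contra! hc
    exact h.col_ne_bot j (funext hc)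
  obtain ⟨i, hi, hmax⟩ := Finset.exists_max_image
    -- The default `0` is never used: only finite entries are compared.
    (Finset.univ.filter fun i => M i j ≠ ⊥) (fun i => (M i j).unbotD 0 - r i)
    (by obtain ⟨i, hi⟩ := hcol; exact ⟨i, by simpa using hi⟩)
  simp only [Finset.mem_filter, Finset.mem_univ, true_and] at hi hmax
  obtain ⟨m, hm⟩ := WithBot.ne_bot_iff_exists.1 hi
  refine ⟨i, r i - m, ?_, fun k => ?_⟩
  · rw [← hm, ← hr, ← WithBot.coe_add, add_sub_cancel]
  · by_cases hk : M k j = ⊥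
    · simp [hk]
    · have := hmax k hk
      obtain ⟨m', hm'⟩ := WithBot.ne_bot_iff_exists.1 hk
      rw [← hm, ← hm', WithBot.unbotD_coe, WithBot.unbotD_coe] at this
      rw [← hm', ← hr, ← WithBot.coe_add, WithBot.coe_le_coe]
      calc m' + (r i - m) = (m' - r k) + (r k + (r i - m)) := by abel
        _ ≤ (m - r i) + (r k + (r i - m)) := by gcongr
        _ = r k := by abel

theorem exists_isSolution {R : Type} [LinearOrder R] [AddCommGroup R] [IsOrderedAddMonoid R]
    {n : ℕ} (hn : 0 < n) {M : Matrix (Fin n) (Fin n) (WithBot R)} {q : Fin n → WithBot R}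
    (h : IsInstance M q) : ∃ w z : Fin n → WithBot R, IsSolution M q w z := by
  classical
  choose f v hfv hle using exists_best_response h
  refine ⟨_, _, isSolution_of_support
    (fun x => ∃ u, n ≤ u ∧ u < 2 * n ∧ f^[u] ⟨0, hn⟩ = x) v (fun j _ => hle j) ?_
    ⟨_, n, le_rfl, by omega, rfl⟩⟩
  intro i hi
  obtain ⟨j, hj, rfl⟩ := exists_iterate_predecessor (s := Finset.univ) (fun _ _ => Finset.mem_univ _)
    (Finset.mem_univ _) (by simp) hi
  exact ⟨j, hj, hfv j⟩

end TNECP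

/-! ### Running times of programs on states with bounded contents -/

namespace RAM

theorem bitLen_le_iff {a : ℤ} {k : ℕ} : bitLen a ≤ k + 1 ↔ a.natAbs < 2 ^ k := by
  rw [bitLen, Nat.add_le_add_iff_right, Nat.size_le]

theorem one_le_bitLen (a : ℤ) : 1 ≤ bitLen a := Nat.le_add_left _ _

theorem natAbs_lt_two_pow (a : ℤ) : a.natAbs < 2 ^ (a.natAbs.size) := Nat.lt_size_self _

theorem bitLen_neg (a : ℤ) : bitLen (-a) = bitLen a := by simp [bitLen]

theorem bitLen_mul_le (a b : ℤ) : bitLen (a * b) ≤ bitLen a + bitLen b := by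
  rw [show bitLen a + bitLen b = (a.natAbs.size + b.natAbs.size + 1) + 1 by
    simp only [bitLen]; omega, bitLen_le_iff, Int.natAbs_mul]
  calc a.natAbs * b.natAbs ≤ 2 ^ a.natAbs.size * 2 ^ b.natAbs.size :=
        Nat.mul_le_mul (natAbs_lt_two_pow a).le (natAbs_lt_two_pow b).le
    _ < _ := by rw [← pow_add]; exact Nat.pow_lt_pow_right (by norm_num) (by omega)

/-- Cruder than maximum plus one, but it is the bound that products obey, so `Expr.width` treats all
operations alike. -/
theorem bitLen_add_le (a b : ℤ) : bitLen (a + b) ≤ bitLen a + bitLen b := by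
  rw [show bitLen a + bitLen b = (a.natAbs.size + b.natAbs.size + 1) + 1 by
    simp only [bitLen]; omega, bitLen_le_iff]
  have h₁ : 2 ^ a.natAbs.size ≤ 2 ^ (a.natAbs.size + b.natAbs.size) :=
    Nat.pow_le_pow_right (by norm_num) (by omega)
  have h₂ : 2 ^ b.natAbs.size ≤ 2 ^ (a.natAbs.size + b.natAbs.size) :=
    Nat.pow_le_pow_right (by norm_num) (by omega)
  have h₃ := natAbs_lt_two_pow a
  have h₄ := natAbs_lt_two_pow b
  have h₅ := Int.natAbs_add_le a b
  rw [pow_succ]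
  omega

theorem bitLen_sub_le (a b : ℤ) : bitLen (a - b) ≤ bitLen a + bitLen b := by
  simpa only [sub_eq_add_neg, bitLen_neg] using bitLen_add_le a (-b)

theorem bitLen_mono {a b : ℤ} (h : a.natAbs ≤ b.natAbs) : bitLen a ≤ bitLen b :=
  Nat.add_le_add_right (Nat.size_le_size h) 1

/-- All contents of the state have bit length at most `K`. -/
structure State.Bounded (K : ℕ) (s : State) : Prop where
  reg : ∀ x, bitLen (s.reg x) ≤ K
  mem : ∀ k a, bitLen (s.mem k a) ≤ K

@[simp]
theorem State.setReg_mem (s : State) (x : ℕ) (v : ℤ) : (s.setReg x v).mem = s.mem := rfl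

@[simp]
theorem State.setReg_reg (s : State) (x y : ℕ) (v : ℤ) :
    (s.setReg x v).reg y = if y = x then v else s.reg y := by
  simp [State.setReg, Function.update_apply]

@[simp]
theorem State.setMem_reg (s : State) (k : ℕ) (a v : ℤ) : (s.setMem k a v).reg = s.reg := rfl

@[simp]
theorem State.setMem_mem (s : State) (k l : ℕ) (a b v : ℤ) :
    (s.setMem k a v).mem l b = if l = k ∧ b = a then v else s.mem l b := by
  by_cases h : l = k
  · subst h; simp [State.setMem, Function.update_apply]
  · simp [State.setMem, h]

theorem State.Bounded.setReg {K : ℕ} {s : State} (h : s.Bounded K) {x : ℕ} {v : ℤ}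
    (hv : bitLen v ≤ K) : (s.setReg x v).Bounded K := by
  refine ⟨fun y => ?_, h.mem⟩
  simp only [State.setReg, Function.update_apply]
  split_ifs
  exacts [hv, h.reg y]

theorem State.Bounded.setMem {K : ℕ} {s : State} (h : s.Bounded K) {k : ℕ} {a v : ℤ}
    (hv : bitLen v ≤ K) : (s.setMem k a v).Bounded K := by
  refine ⟨h.reg, fun l b => ?_⟩
  simp only [State.setMem, Function.update_apply]
  split_ifs
  · rw [Function.update_apply]
    split_ifs
    exacts [hv, h.mem k b]
  · exact h.mem l b

/-- The value of `e` has bit length at most `e.width * K` if the constants and the contents of the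
state have bit length at most `K`. -/
def Expr.width : Expr → ℕ
  | .const _ => 1
  | .reg _ => 1
  | .load _ _ => 1
  | .add e₁ e₂ => e₁.width + e₂.width
  | .sub e₁ e₂ => e₁.width + e₂.width
  | .mul e₁ e₂ => e₁.width + e₂.width

/-- The cost of `e` is at most `e.weight * K` if the constants and the contents of the state have
bit length at most `K`. -/
def Expr.weight : Expr → ℕ
  | .const _ => 1
  | .reg _ => 1
  | .load _ addr => addr.weight + 1
  | .add e₁ e₂ => e₁.weight + e₂.weight + (e₁.width + e₂.width)
  | .sub e₁ e₂ => e₁.weight + e₂.weight + (e₁.width + e₂.width)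
  | .mul e₁ e₂ => e₁.weight + e₂.weight + (e₁.width + e₂.width)

/-- All constants of `e` have bit length at most `K`. -/
def Expr.ConstsBounded (K : ℕ) : Expr → Prop
  | .const c => bitLen c ≤ K
  | .reg _ => True
  | .load _ addr => addr.ConstsBounded K
  | .add e₁ e₂ => e₁.ConstsBounded K ∧ e₂.ConstsBounded K
  | .sub e₁ e₂ => e₁.ConstsBounded K ∧ e₂.ConstsBounded K
  | .mul e₁ e₂ => e₁.ConstsBounded K ∧ e₂.ConstsBounded K

theorem Expr.bitLen_eval_le {K : ℕ} {s : State} (hs : s.Bounded K) :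
    ∀ {e : Expr}, e.ConstsBounded K → bitLen (e.eval s) ≤ e.width * K
  | .const _, h => by simpa [Expr.eval, Expr.width, Expr.ConstsBounded] using h
  | .reg x, _ => by simpa [Expr.eval, Expr.width] using hs.reg x
  | .load k addr, _ => by simpa [Expr.eval, Expr.width] using hs.mem k _
  | .add e₁ e₂, h => (bitLen_add_le _ _).trans <| by
      have h₁ := bitLen_eval_le hs h.1
      have h₂ := bitLen_eval_le hs h.2
      rw [Expr.width, add_mul]; omega
  | .sub e₁ e₂, h => (bitLen_sub_le _ _).trans <| by
      have h₁ := bitLen_eval_le hs h.1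
      have h₂ := bitLen_eval_le hs h.2
      rw [Expr.width, add_mul]; omega
  | .mul e₁ e₂, h => (bitLen_mul_le _ _).trans <| by
      have h₁ := bitLen_eval_le hs h.1
      have h₂ := bitLen_eval_le hs h.2
      rw [Expr.width, add_mul]; omega

theorem Expr.cost_le {K : ℕ} {s : State} (hs : s.Bounded K) :
    ∀ {e : Expr}, e.ConstsBounded K → e.cost s ≤ e.weight * K
  | .const _, h => by simpa [Expr.cost, Expr.weight, Expr.ConstsBounded] using h
  | .reg x, _ => by simpa [Expr.cost, Expr.weight] using hs.reg x
  | .load k addr, h => by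
      have h₁ := cost_le hs (e := addr) h
      have h₂ := hs.mem k (addr.eval s)
      simp only [Expr.cost, Expr.weight, Expr.eval, add_mul, one_mul]; omega
  | .add e₁ e₂, h => by
      have h₀ := bitLen_eval_le hs (e := .add e₁ e₂) h
      have h₁ := cost_le hs h.1
      have h₂ := cost_le hs h.2
      simp only [Expr.cost, Expr.weight, Expr.width, add_mul] at *; omega
  | .sub e₁ e₂, h => by
      have h₀ := bitLen_eval_le hs (e := .sub e₁ e₂) h
      have h₁ := cost_le hs h.1
      have h₂ := cost_le hs h.2
      simp only [Expr.cost, Expr.weight, Expr.width, add_mul] at *; omega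
  | .mul e₁ e₂, h => by
      have h₀ := bitLen_eval_le hs (e := .mul e₁ e₂) h
      have h₁ := cost_le hs h.1
      have h₂ := cost_le hs h.2
      simp only [Expr.cost, Expr.weight, Expr.width, add_mul] at *; omega

/-- Started in `s`, the program `p` halts after time at most `c * K` in a state satisfying `Q`. -/
def Runs (K c : ℕ) (p : Prog) (s : State) (Q : State → Prop) : Prop :=
  ∃ s' t, Exec p s s' t ∧ t ≤ c * K ∧ Q s'

namespace Runs

variable {K c c₁ c₂ : ℕ} {p p₁ p₂ : Prog} {s : State} {e : Expr} {Q Q' : State → Prop}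

theorem mono (h : Runs K c₁ p s Q) (hc : c₁ ≤ c₂) (hQ : ∀ s', Q s' → Q' s') :
    Runs K c₂ p s Q' := by
  obtain ⟨s', t, hex, ht, hq⟩ := h
  exact ⟨s', t, hex, ht.trans (Nat.mul_le_mul_right K hc), hQ s' hq⟩

theorem one_le_of_bounded (hs : s.Bounded K) : 1 ≤ K := (one_le_bitLen _).trans (hs.reg 0)

theorem test_cost_le (hs : s.Bounded K) (he : e.ConstsBounded K) :
    1 + e.cost s ≤ (1 + e.weight) * K := by
  have h₁ := one_le_of_bounded hs
  have h₂ := Expr.cost_le hs he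
  rw [add_mul, one_mul]
  omega

theorem skip (hs : s.Bounded K) (hQ : Q s) : Runs K 1 .skip s Q :=
  ⟨s, 1, .skip s, by rw [one_mul]; exact one_le_of_bounded hs, hQ⟩

theorem assign {x : ℕ} {v : ℤ} (hs : s.Bounded K) (he : e.ConstsBounded K) (hv : e.eval s = v)
    (hQ : Q (s.setReg x v)) : Runs K (1 + e.weight) (.assign x e) s Q := by
  subst hv
  exact ⟨_, _, .assign s x e, test_cost_le hs he, hQ⟩

theorem store {k : ℕ} {a : Expr} {b v : ℤ} (hs : s.Bounded K) (ha : a.ConstsBounded K)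
    (he : e.ConstsBounded K) (hb : a.eval s = b) (hv : e.eval s = v) (hQ : Q (s.setMem k b v)) :
    Runs K (1 + a.weight + e.weight) (.store k a e) s Q := by
  subst hb hv
  refine ⟨_, _, .store s k a e, ?_, hQ⟩
  have h₁ := test_cost_le hs ha
  have h₂ := Expr.cost_le hs he
  rw [add_mul]
  omega

theorem seq (h : Runs K c₁ p₁ s fun s' => Runs K c₂ p₂ s' Q) :
    Runs K (c₁ + c₂) (.seq p₁ p₂) s Q := by
  obtain ⟨s₁, t₁, h₁, ht₁, s₂, t₂, h₂, ht₂, hQ⟩ := h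
  exact ⟨s₂, t₁ + t₂, .seq h₁ h₂, by rw [add_mul]; omega, hQ⟩

theorem assign_seq {x : ℕ} {v : ℤ} (hs : s.Bounded K) (he : e.ConstsBounded K) (hv : e.eval s = v)
    (h : Runs K c p (s.setReg x v) Q) : Runs K (1 + e.weight + c) (.seq (.assign x e) p) s Q :=
  seq (assign hs he hv h)

theorem store_seq {k : ℕ} {a : Expr} {b v : ℤ} (hs : s.Bounded K) (ha : a.ConstsBounded K)
    (he : e.ConstsBounded K) (hb : a.eval s = b) (hv : e.eval s = v)
    (h : Runs K c p (s.setMem k b v) Q) :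
    Runs K (1 + a.weight + e.weight + c) (.seq (.store k a e) p) s Q :=
  seq (store hs ha he hb hv h)

/-- Charging both branches avoids a maximum and loses only a constant. -/
theorem ite {v : ℤ} (hs : s.Bounded K) (he : e.ConstsBounded K) (hv : e.eval s = v)
    (h₁ : 0 < v → Runs K c₁ p₁ s Q) (h₂ : v ≤ 0 → Runs K c₂ p₂ s Q) :
    Runs K (1 + e.weight + (c₁ + c₂)) (.ite e p₁ p₂) s Q := by
  subst hv
  have ht := test_cost_le hs he
  rcases lt_or_ge 0 (e.eval s) with h | h
  · obtain ⟨s', t, hex, htc, hQ⟩ := h₁ h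
    exact ⟨s', _, .ite_true h hex, by rw [add_mul, add_mul c₁]; omega, hQ⟩
  · obtain ⟨s', t, hex, htc, hQ⟩ := h₂ h
    exact ⟨s', _, .ite_false h hex, by rw [add_mul, add_mul c₁]; omega, hQ⟩

/-- The invariant is indexed by the number of completed rounds, so it proves termination after
exactly `N` rounds along with correctness. The test is paid for `N + 1` times. -/
theorem loop {I : ℕ → State → Prop} {N : ℕ} (he : e.ConstsBounded K)
    (hI : ∀ i s, I i s → s.Bounded K)
    (hstep : ∀ i, i < N → ∀ s, I i s → 0 < e.eval s ∧ Runs K c p s (I (i + 1)))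
    (hend : ∀ s, I N s → e.eval s ≤ 0) (h₀ : I 0 s) :
    Runs K (N * (1 + e.weight + c) + (1 + e.weight)) (.loop e p) s (I N) := by
  have key : ∀ d i, d + i = N → ∀ s, I i s →
      Runs K (d * (1 + e.weight + c) + (1 + e.weight)) (.loop e p) s (I N) := by
    intro d
    induction d with
    | zero =>
      intro i hi s hs
      obtain rfl : i = N := by omega
      refine ⟨s, _, .loop_false (hend s hs), ?_, hs⟩
      rw [Nat.zero_mul, Nat.zero_add]
      exact test_cost_le (hI _ s hs) he
    | succ d ih =>
      intro i hi s hs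
      have ht := test_cost_le (hI i s hs) he
      obtain ⟨hpos, s₁, t₁, h₁, ht₁, hQ⟩ := hstep i (by omega) s hs
      obtain ⟨s₂, t₂, h₂, ht₂, hQ₂⟩ := ih (i + 1) (by omega) s₁ hQ
      refine ⟨s₂, _, .loop_true hpos h₁ h₂, ?_, hQ₂⟩
      calc 1 + e.cost s + t₁ + t₂ ≤ (1 + e.weight) * K + c * K
            + (d * (1 + e.weight + c) + (1 + e.weight)) * K := by omega
        _ = _ := by ring
  exact key N 0 rfl s h₀

end Runs

end RAM

/-! ### A program computing the cycle -/

namespace TNECP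

/-- The search for the largest of the fractions `a i / b i` with `i < m`, where `(-1, 0)` stands
for `-∞`: numerator, denominator and (first) index of the largest fraction. -/
def best (a b : ℕ → ℤ) : ℕ → ℤ × ℤ × ℕ
  | 0 => (-1, 0, 0)
  | i + 1 =>
    if 0 < a i * (best a b i).2.1 - (best a b i).1 * b i then (a i, b i, i) else best a b i

/-- Against the initial `(-1, 0)` the cross-multiplied test reads `0 < b i`, so every genuine
fraction beats `-∞`; by `ha`, no `-∞` beats a genuine fraction. One integer test thus needs no case
distinction. -/
theorem best_spec {a b : ℕ → ℤ} (hb : ∀ i, 0 ≤ b i) (ha : ∀ i, b i = 0 → a i ≤ 0) (m : ℕ) :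
    (∀ i < m, a i * (best a b m).2.1 ≤ (best a b m).1 * b i) ∧
      (best a b m = (-1, 0, 0) ∨
        0 < (best a b m).2.1 ∧ (best a b m).2.2 < m ∧ a (best a b m).2.2 = (best a b m).1 ∧
          b (best a b m).2.2 = (best a b m).2.1) := by
  induction m with
  | zero => simp [best]
  | succ m ih =>
    obtain ⟨h₁, h₂⟩ := ih
    rw [best]
    split_ifs with h
    · have hbm : 0 < b m := by
        rcases h₂ with h₂ | ⟨h₂, -⟩
        · simpa [h₂] using h
        · refine lt_of_le_of_ne (hb m) fun h0 => ?_
          have h3 := mul_nonpos_of_nonpos_of_nonneg (ha m h0.symm) h₂.le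
          rw [← h0] at h
          linarith
      refine ⟨fun i hi => ?_, Or.inr ⟨hbm, by simp, rfl, rfl⟩⟩
      rcases Nat.lt_succ_iff_lt_or_eq.1 hi with hi | rfl
      · have h₃ := h₁ i hi
        rcases h₂ with h₂ | ⟨h₂, -⟩
        · have hi0 : b i = 0 := by
            rw [h₂] at h₃
            have := hb i
            simp at h₃
            omega
          simpa [hi0] using mul_nonpos_of_nonpos_of_nonneg (ha i hi0) hbm.le
        -- Transitivity of the comparison of fractions, through the old best one, whose positive
        -- denominator is cancelled.
        · refine le_of_mul_le_mul_right ?_ h₂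
          nlinarith [mul_le_mul_of_nonneg_right h₃ hbm.le,
            mul_le_mul_of_nonneg_right (sub_pos.1 h).le (hb i)]
      · simp
    · refine ⟨fun i hi => ?_, h₂.imp_right fun h₃ => ⟨h₃.1, by omega, h₃.2.2⟩⟩
      rcases Nat.lt_succ_iff_lt_or_eq.1 hi with hi | rfl
      · exact h₁ i hi
      · linarith

theorem best_pos {a b : ℕ → ℤ} (hb : ∀ i, 0 ≤ b i) (ha : ∀ i, b i = 0 → a i ≤ 0) {m : ℕ}
    (hm : ∃ i < m, 0 < b i) :
    0 < (best a b m).2.1 ∧ (best a b m).2.2 < m ∧ a (best a b m).2.2 = (best a b m).1 ∧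
      b (best a b m).2.2 = (best a b m).2.1 := by
  obtain ⟨h₁, h₂⟩ := best_spec hb ha m
  refine h₂.resolve_left fun h => ?_
  obtain ⟨i, hi, hpos⟩ := hm
  have := h₁ i hi
  simp [h] at this
  omega

/-- Numerator of `M i j - q i`, for an instance of dimension `n` stored in banks `0, …, 3`. -/
def slackNum (m : ℕ → ℤ → ℤ) (n j i : ℕ) : ℤ :=
  m 0 ((i : ℤ) * n + j) * m 3 i - m 2 i * m 1 ((i : ℤ) * n + j)

/-- Denominator of `M i j - q i`, for an instance of dimension `n` stored in banks `0, …, 3`. -/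
def slackDen (m : ℕ → ℤ → ℤ) (n j i : ℕ) : ℤ := m 1 ((i : ℤ) * n + j) * m 3 i

/-- The largest of the fractions `M i j - q i` in column `j`. -/
def bestSlack (m : ℕ → ℤ → ℤ) (n j : ℕ) : ℕ → ℤ × ℤ × ℕ :=
  best (slackNum m n j) (slackDen m n j)

/-- The row where `M i j - q i` is largest. -/
def next (m : ℕ → ℤ → ℤ) (n j : ℕ) : ℕ := (bestSlack m n j n).2.2

theorem slackNum_congr {m m' : ℕ → ℤ → ℤ} (h : ∀ k < 4, m k = m' k) :
    slackNum m = slackNum m' := by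
  funext n j i
  rw [slackNum, slackNum, h 0 (by norm_num), h 1 (by norm_num), h 2 (by norm_num),
    h 3 (by norm_num)]

theorem slackDen_congr {m m' : ℕ → ℤ → ℤ} (h : ∀ k < 4, m k = m' k) :
    slackDen m = slackDen m' := by
  funext n j i
  rw [slackDen, slackDen, h 1 (by norm_num), h 3 (by norm_num)]

/-- The program never writes to banks `0` to `3`, so searching the current memory is searching the
input. -/
theorem bestSlack_congr {m m' : ℕ → ℤ → ℤ} (h : ∀ k < 4, m k = m' k) :
    bestSlack m = bestSlack m' := by
  funext n j
  rw [bestSlack, bestSlack, slackNum_congr h, slackDen_congr h]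

open RAM

/-- Copy `q` from banks `2`, `3` to banks `4`, `5`. -/
def copyBody : Prog :=
  .seq (.store 4 (.reg 1) (.load 2 (.reg 1))) <|
  .seq (.store 5 (.reg 1) (.load 3 (.reg 1))) <|
  .assign 1 (.add (.reg 1) (.const 1))

/-- Compare row `i` (register `1`) with the best row found so far (registers `4`, `5`, `6`) in the
column in register `3`. -/
def searchBody : Prog :=
  .seq (.assign 7 (.sub
    (.mul (.load 0 (.add (.mul (.reg 1) (.reg 0)) (.reg 3))) (.load 3 (.reg 1)))
    (.mul (.load 2 (.reg 1)) (.load 1 (.add (.mul (.reg 1) (.reg 0)) (.reg 3)))))) <|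
  .seq (.assign 8
    (.mul (.load 1 (.add (.mul (.reg 1) (.reg 0)) (.reg 3))) (.load 3 (.reg 1)))) <|
  .seq (.ite (.sub (.mul (.reg 7) (.reg 5)) (.mul (.reg 4) (.reg 8)))
    (.seq (.assign 4 (.reg 7)) (.seq (.assign 5 (.reg 8)) (.assign 6 (.reg 1))))
    .skip) <|
  .assign 1 (.add (.reg 1) (.const 1))

/-- Find the best row in the column in register `3`. -/
def search : Prog :=
  .seq (.assign 1 (.const 0)) <|
  .seq (.assign 4 (.const (-1))) <|
  .seq (.assign 5 (.const 0)) <|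
  .seq (.assign 6 (.const 0)) <|
  .loop (.sub (.reg 0) (.reg 1)) searchBody

/-- Erase `w` and write `z` at the column in register `3`. -/
def record : Prog :=
  .seq (.store 5 (.reg 3) (.const 0)) <|
  .seq (.store 6 (.reg 3) (.sub (.const 0) (.reg 4))) <|
  .store 7 (.reg 3) (.reg 5)

/-- One step of the walk; in the second half of the walk the solution is recorded. -/
def walkBody : Prog :=
  .seq search <|
  .seq (.ite (.sub (.add (.reg 0) (.const 1)) (.reg 2)) record .skip) <|
  .seq (.assign 3 (.reg 6)) <|
  .assign 2 (.sub (.reg 2) (.const 1))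

/-- The program solving the complementarity problem. -/
def solver : Prog :=
  .seq (.loop (.sub (.reg 0) (.reg 1)) copyBody) <|
  .seq (.assign 2 (.add (.reg 0) (.reg 0))) <|
  .loop (.reg 2) walkBody

/-! ### Correctness and cost of the program by loop invariants -/

theorem bitLen_slackDen_le {L n j i : ℕ} {m : ℕ → ℤ → ℤ} (hm : ∀ k < 4, ∀ a, bitLen (m k a) ≤ L) :
    bitLen (slackDen m n j i) ≤ 4 * L := by
  have h₁ := bitLen_mul_le (m 1 ((i : ℤ) * n + j)) (m 3 i)
  have h₂ := hm 1 (by norm_num) ((i : ℤ) * n + j)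
  have h₃ := hm 3 (by norm_num) i
  rw [slackDen]
  omega

theorem bitLen_slackNum_le {L n j i : ℕ} {m : ℕ → ℤ → ℤ} (hm : ∀ k < 4, ∀ a, bitLen (m k a) ≤ L) :
    bitLen (slackNum m n j i) ≤ 4 * L := by
  have h₁ := bitLen_mul_le (m 0 ((i : ℤ) * n + j)) (m 3 i)
  have h₂ := bitLen_mul_le (m 2 i) (m 1 ((i : ℤ) * n + j))
  have h₃ := bitLen_sub_le (m 0 ((i : ℤ) * n + j) * m 3 i) (m 2 i * m 1 ((i : ℤ) * n + j))
  have h₄ := hm 0 (by norm_num) ((i : ℤ) * n + j)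
  have h₅ := hm 1 (by norm_num) ((i : ℤ) * n + j)
  have h₆ := hm 2 (by norm_num) i
  have h₇ := hm 3 (by norm_num) i
  rw [slackNum]
  omega

/-- The states reached by the search after `i` rows, started in `s₀`. -/
structure SearchInv (K n j : ℕ) (s₀ : State) (i : ℕ) (s : State) : Prop where
  bounded : s.Bounded K
  mem : s.mem = s₀.mem
  le : i ≤ n
  reg0 : s.reg 0 = n
  reg1 : s.reg 1 = i
  reg2 : s.reg 2 = s₀.reg 2
  reg3 : s.reg 3 = j
  reg4 : s.reg 4 = (bestSlack s₀.mem n j i).1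
  reg5 : s.reg 5 = (bestSlack s₀.mem n j i).2.1
  reg6 : s.reg 6 = (bestSlack s₀.mem n j i).2.2

/-- The same bound `4 * L` survives each round, since only slacks and row indices are stored. The
longer products in the test are never stored; `Expr.weight` accounts for their cost. -/
theorem SearchInv.step {L n j i : ℕ} {s₀ s : State} (hm : ∀ k < 4, ∀ a, bitLen (s₀.mem k a) ≤ L)
    (hn : bitLen n ≤ L) (hL : 2 ≤ L) (hi : i < n) (h : SearchInv (4 * L) n j s₀ i s) :
    Runs (4 * L) 70 searchBody s (SearchInv (4 * L) n j s₀ (i + 1)) := by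
  obtain ⟨hb, hmem, -, h0, h1, h2, h3, h4, h5, h6⟩ := h
  have hone : bitLen (1 : ℤ) ≤ 4 * L := by
    have : bitLen (1 : ℤ) = 2 := by simp [bitLen]
    omega
  have hi1 : bitLen ((i : ℤ) + 1) ≤ 4 * L := by
    have := bitLen_mono (a := (i : ℤ) + 1) (b := n) (by omega)
    omega
  have hilen : bitLen (i : ℤ) ≤ 4 * L := by
    have := bitLen_mono (a := (i : ℤ)) (b := n) (by omega)
    omega
  have hA := bitLen_slackNum_le (n := n) (j := j) (i := i) hm
  have hB := bitLen_slackDen_le (n := n) (j := j) (i := i) hm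
  have hb₁ := hb.setReg (x := 7) hA
  have hb₂ := hb₁.setReg (x := 8) hB
  refine Runs.mono (Runs.assign_seq hb (v := slackNum s₀.mem n j i) (by simp [Expr.ConstsBounded])
    (by simp [Expr.eval, hmem, h0, h1, h3, slackNum]) <|
    Runs.assign_seq hb₁ (v := slackDen s₀.mem n j i) (by simp [Expr.ConstsBounded])
    (by simp [Expr.eval, hmem, h0, h1, h3, slackDen]) <|
    Runs.seq <| Runs.ite hb₂ (v := slackNum s₀.mem n j i * (bestSlack s₀.mem n j i).2.1 -
      (bestSlack s₀.mem n j i).1 * slackDen s₀.mem n j i) (by simp [Expr.ConstsBounded])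
    (by simp [Expr.eval, h4, h5])
    (fun hlt => Runs.assign_seq hb₂ (v := slackNum s₀.mem n j i) trivial (by simp [Expr.eval]) <|
      Runs.assign_seq (hb₂.setReg hA) (v := slackDen s₀.mem n j i) trivial (by simp [Expr.eval]) <|
      Runs.assign ((hb₂.setReg hA).setReg hB) (v := i) trivial (by simp [Expr.eval, h1]) <|
      Runs.assign (((hb₂.setReg hA).setReg hB).setReg hilen) (v := i + 1)
        (by simp [Expr.ConstsBounded, hone]) (by simp [Expr.eval, h1]) ?_)
    (fun hle => Runs.skip hb₂ <| Runs.assign hb₂ (v := i + 1)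
        (by simp [Expr.ConstsBounded, hone]) (by simp [Expr.eval, h1]) ?_))
    (by simp [Expr.weight, Expr.width]) (fun _ h => h)
  · have hbest : bestSlack s₀.mem n j (i + 1) = (slackNum s₀.mem n j i, slackDen s₀.mem n j i, i) :=
      if_pos hlt
    refine ⟨(((hb₂.setReg hA).setReg hB).setReg hilen).setReg hi1, ?_, hi, ?_, ?_, ?_, ?_, ?_, ?_, ?_⟩
      <;> simp [hbest, hmem, h0, h2, h3]
  · have hbest : bestSlack s₀.mem n j (i + 1) = bestSlack s₀.mem n j i := if_neg hle.not_gt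
    refine ⟨hb₂.setReg hi1, ?_, hi, ?_, ?_, ?_, ?_, ?_, ?_, ?_⟩
      <;> simp [hbest, hmem, h0, h2, h3, h4, h5, h6]

theorem runs_search {L n j : ℕ} {s : State} (hb : s.Bounded (4 * L))
    (hm : ∀ k < 4, ∀ a, bitLen (s.mem k a) ≤ L) (hn : bitLen n ≤ L) (hL : 2 ≤ L)
    (h0 : s.reg 0 = n) (h3 : s.reg 3 = j) :
    Runs (4 * L) (n * 75 + 13) search s (SearchInv (4 * L) n j s n) := by
  have hzero : bitLen (0 : ℤ) ≤ 4 * L := by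
    have : bitLen (0 : ℤ) = 1 := by simp [bitLen]
    omega
  have hneg : bitLen (-1 : ℤ) ≤ 4 * L := by
    have : bitLen (-1 : ℤ) = 2 := by simp [bitLen]
    omega
  have hb₁ := hb.setReg (x := 1) hzero
  have hb₂ := hb₁.setReg (x := 4) hneg
  have hb₃ := hb₂.setReg (x := 5) hzero
  have hb₄ := hb₃.setReg (x := 6) hzero
  refine Runs.mono (Runs.assign_seq hb hzero rfl <| Runs.assign_seq hb₁ hneg rfl <|
    Runs.assign_seq hb₂ hzero rfl <| Runs.assign_seq hb₃ hzero rfl <|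
    Runs.loop (I := SearchInv (4 * L) n j s) (N := n) (c := 70) (by simp [Expr.ConstsBounded])
      (fun _ _ h => h.bounded)
      (fun i hi s' h => ⟨by simpa [Expr.eval, h.reg0, h.reg1] using hi, h.step hm hn hL hi⟩)
      (fun s' h => by simp [Expr.eval, h.reg0, h.reg1]) ?_)
    (by simp [Expr.weight, Expr.width]; omega) (fun _ h => h)
  refine ⟨hb₄, ?_, Nat.zero_le n, ?_, ?_, ?_, ?_, ?_, ?_, ?_⟩ <;>
    simp [Expr.eval, h0, h3, bestSlack, best]

/-- Column `x` is visited in the second half of the first `t` steps of the walk. -/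
def Visited (m : ℕ → ℤ → ℤ) (n t x : ℕ) : Prop := ∃ u, n ≤ u ∧ u < t ∧ (next m n)^[u] 0 = x

theorem visited_succ {m : ℕ → ℤ → ℤ} {n t x : ℕ} :
    Visited m n (t + 1) x ↔ Visited m n t x ∨ n ≤ t ∧ (next m n)^[t] 0 = x := by
  constructor
  · rintro ⟨u, h₁, h₂, h₃⟩
    rcases Nat.lt_succ_iff_lt_or_eq.1 h₂ with h | rfl
    exacts [.inl ⟨u, h₁, h, h₃⟩, .inr ⟨h₁, h₃⟩]
  · rintro (⟨u, h₁, h₂, h₃⟩ | ⟨h₁, h₃⟩)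
    exacts [⟨u, h₁, h₂.trans (Nat.lt_succ_self t), h₃⟩, ⟨t, h₁, Nat.lt_succ_self t, h₃⟩]

/-- The contents of the output banks after `t` steps of the walk. -/
structure OutputInv (m₀ : ℕ → ℤ → ℤ) (n t : ℕ) (m : ℕ → ℤ → ℤ) : Prop where
  input : ∀ k < 4, m k = m₀ k
  wNum : ∀ x < n, m 4 x = m₀ 2 x
  visited : ∀ x < n, Visited m₀ n t x →
    m 5 x = 0 ∧ m 6 x = -(bestSlack m₀ n x n).1 ∧ m 7 x = (bestSlack m₀ n x n).2.1
  unvisited : ∀ x < n, ¬ Visited m₀ n t x → m 5 x = m₀ 3 x ∧ m 7 x = 0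

/-- The states reached by the walk after `t` steps. -/
structure WalkInv (K : ℕ) (m₀ : ℕ → ℤ → ℤ) (n t : ℕ) (s : State) : Prop where
  bounded : s.Bounded K
  mem : OutputInv m₀ n t s.mem
  reg0 : s.reg 0 = n
  reg2 : s.reg 2 = 2 * n - t
  reg3 : s.reg 3 = ((next m₀ n)^[t] 0 : ℕ)

theorem WalkInv.step {L n t : ℕ} {m₀ : ℕ → ℤ → ℤ} {s : State}
    (hm : ∀ k < 4, ∀ a, bitLen (m₀ k a) ≤ L) (hn : bitLen n ≤ L) (hL : 2 ≤ L) (ht : t < 2 * n)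
    (h : WalkInv (4 * L) m₀ n t s) :
    Runs (4 * L) (n * 75 + 60) walkBody s (WalkInv (4 * L) m₀ n (t + 1)) := by
  have hzero : bitLen (0 : ℤ) ≤ 4 * L := by
    have : bitLen (0 : ℤ) = 1 := by simp [bitLen]
    omega
  have hone : bitLen (1 : ℤ) ≤ 4 * L := by
    have : bitLen (1 : ℤ) = 2 := by simp [bitLen]
    omega
  refine Runs.mono (Runs.seq <| (runs_search h.bounded
    (fun k hk a => by rw [h.mem.input k hk]; exact hm k hk a) hn hL h.reg0 h.reg3).mono le_rfl
    (Q' := fun s' => Runs (4 * L) 45 _ s' _) ?_) (by omega) fun _ h => h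
  intro s₁ h₁
  obtain ⟨hb, hmem, -, h0, -, h2, h3, h4, h5, h6⟩ := h₁
  set j := (next m₀ n)^[t] 0 with hj
  rw [bestSlack_congr h.mem.input] at h4 h5 h6
  rw [h.reg2] at h2
  have hnext : (next m₀ n)^[t + 1] 0 = (bestSlack m₀ n j n).2.2 := by
    rw [Function.iterate_succ_apply', ← hj, next]
  have hlast : ∀ s₂ : State, s₂.Bounded (4 * L) → s₂.reg = s₁.reg →
      OutputInv m₀ n (t + 1) s₂.mem →
      Runs (4 * L) 7 (.seq (.assign 3 (.reg 6)) (.assign 2 (.sub (.reg 2) (.const 1)))) s₂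
        (WalkInv (4 * L) m₀ n (t + 1)) := by
    -- The two closing assignments, common to recording and non-recording steps.
    intro s₂ hb₂ hreg hout
    have hb₃ := hb₂.setReg (x := 3) (hb₂.reg 6)
    have hlen : bitLen (2 * n - t - 1 : ℤ) ≤ 4 * L := by
      have h₁ := bitLen_mono (a := (2 * n - t - 1 : ℤ)) (b := n + n) (by omega)
      have h₂ := bitLen_add_le (n : ℤ) n
      omega
    refine (Runs.assign_seq hb₂ (by simp [Expr.ConstsBounded]) rfl <| Runs.assign hb₃ (v := 2 * n - t - 1)
      (by simp [Expr.ConstsBounded, hone]) (by simp [Expr.eval, hreg, h2]) ?_).mono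
      (by simp [Expr.weight, Expr.width]) fun _ h => h
    refine ⟨hb₃.setReg hlen, hout, ?_, ?_, ?_⟩
    · simp [hreg, h0]
    · simp; ring
    · simp [hnext, hreg, h6, Expr.eval]
  have hneg : bitLen (-(bestSlack m₀ n j n).1) ≤ 4 * L := by
    rw [bitLen_neg, ← h4]; exact hb.reg 4
  have hb₁ := hb.setMem (k := 5) (a := j) hzero
  have hb₂ := hb₁.setMem (k := 6) (a := j) hneg
  have hb₃ := hb₂.setMem (k := 7) (a := j) (h5 ▸ hb.reg 5)
  -- Register `2` holds `2 * n - t`, so the test is positive exactly when `n ≤ t`.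
  refine Runs.mono (Runs.seq <| Runs.ite hb (v := t + 1 - n) (by simp [Expr.ConstsBounded, hone])
    (by simp [Expr.eval, h0, h2]; ring)
    (fun hlt => Runs.store_seq hb trivial hzero (b := j) (v := 0) h3 rfl <|
      Runs.store_seq hb₁ trivial (by simp [Expr.ConstsBounded, hzero]) (b := j)
        (v := -(bestSlack m₀ n j n).1) h3 (by simp [Expr.eval, h4]) <|
      Runs.store hb₂ trivial trivial (b := j) (v := (bestSlack m₀ n j n).2.1) h3 h5 <|
        hlast _ hb₃ rfl ?_)
    (fun hle => Runs.skip hb <| hlast _ hb rfl ?_))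
    (by simp [Expr.weight, Expr.width]) fun _ h => h
  · have hnt : n ≤ t := by omega
    refine ⟨fun k hk => ?_, fun x hx => ?_, fun x hx hv => ?_, fun x hx hv => ?_⟩
    · funext a
      have e5 : k ≠ 5 := by omega
      have e6 : k ≠ 6 := by omega
      have e7 : k ≠ 7 := by omega
      simp [e5, e6, e7, hmem, h.mem.input k hk]
    · simp [hmem, h.mem.wNum x hx]
    -- A column met again is overwritten with the same values, as these depend only on the column.
    · by_cases hxj : x = j
      · simp [hxj]
      · have := h.mem.visited x hx ((visited_succ.1 hv).resolve_right fun h => hxj h.2.symm)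
        simpa [hxj, hmem] using this
    · have hxj : x ≠ j := fun e => hv (visited_succ.2 (.inr ⟨hnt, e.symm⟩))
      have := h.mem.unvisited x hx fun h => hv (visited_succ.2 (.inl h))
      simpa [hxj, hmem] using this
  · have hiff : ∀ x, Visited m₀ n (t + 1) x ↔ Visited m₀ n t x := fun x => by
      rw [visited_succ, or_iff_left]
      omega
    rw [hmem]
    exact ⟨h.mem.input, h.mem.wNum, fun x hx hv => h.mem.visited x hx ((hiff x).1 hv),
      fun x hx hv => h.mem.unvisited x hx fun h => hv ((hiff x).2 h)⟩

/-- The states reached after copying `i` entries of `q`. -/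
structure CopyInv (K : ℕ) (m₀ : ℕ → ℤ → ℤ) (n i : ℕ) (s : State) : Prop where
  bounded : s.Bounded K
  input : ∀ k < 4, s.mem k = m₀ k
  copied : ∀ x < i, s.mem 4 x = m₀ 2 x ∧ s.mem 5 x = m₀ 3 x
  empty : ∀ x, s.mem 7 x = 0
  le : i ≤ n
  reg0 : s.reg 0 = n
  reg1 : s.reg 1 = i
  reg3 : s.reg 3 = 0

theorem CopyInv.step {L n i : ℕ} {m₀ : ℕ → ℤ → ℤ} {s : State} (hn : bitLen n ≤ L) (hL : 2 ≤ L)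
    (hi : i < n) (h : CopyInv (4 * L) m₀ n i s) :
    Runs (4 * L) 20 copyBody s (CopyInv (4 * L) m₀ n (i + 1)) := by
  have hone : bitLen (1 : ℤ) ≤ 4 * L := by
    have : bitLen (1 : ℤ) = 2 := by simp [bitLen]
    omega
  have hi1 : bitLen ((i : ℤ) + 1) ≤ 4 * L := by
    have := bitLen_mono (a := (i : ℤ) + 1) (b := n) (by omega)
    omega
  obtain ⟨hb, hin, hcop, hemp, -, h0, h1, h3⟩ := h
  have hb₁ := hb.setMem (k := 4) (a := i) (hb.mem 2 i)
  have hb₂ := hb₁.setMem (k := 5) (a := i) (hb.mem 3 i)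
  refine Runs.mono (Runs.store_seq hb trivial trivial h1 (v := s.mem 2 i) (by simp [Expr.eval, h1])
    <| Runs.store_seq hb₁ trivial trivial h1 (v := s.mem 3 i) (by simp [Expr.eval, h1])
    <| Runs.assign hb₂ (v := i + 1) (by simp [Expr.ConstsBounded, hone]) (by simp [Expr.eval, h1])
      ?_) (by simp [Expr.weight, Expr.width]) fun _ h => h
  refine ⟨hb₂.setReg hi1, fun k hk => ?_, fun x hx => ?_, fun x => ?_, hi, ?_, ?_, ?_⟩
  · funext a
    have e4 : k ≠ 4 := by omega
    have e5 : k ≠ 5 := by omega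
    simp [e4, e5, hin k hk]
  · rcases Nat.lt_succ_iff_lt_or_eq.1 hx with hx | rfl
    · have hxi : x ≠ i := hx.ne
      simp [hxi, hcop x hx]
    · simp [hin]
  · simp [hemp]
  · simp [h0]
  · simp
  · simp [h3]

theorem runs_solver {L n : ℕ} {s : State} (hb : s.Bounded L) (hL : 2 ≤ L) (h0 : s.reg 0 = n)
    (h1 : s.reg 1 = 0) (h3 : s.reg 3 = 0) (h7 : ∀ x, s.mem 7 x = 0) :
    Runs (4 * L) (n * 25 + 2 * n * (n * 75 + 62) + 20) solver s
      fun s' => OutputInv s.mem n (2 * n) s'.mem := by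
  have hn : bitLen n ≤ L := h0 ▸ hb.reg 0
  have hb₀ : s.Bounded (4 * L) := ⟨fun x => (hb.reg x).trans (by omega),
    fun k a => (hb.mem k a).trans (by omega)⟩
  have hlen : bitLen (2 * n : ℤ) ≤ 4 * L := by
    have h₂ := bitLen_add_le (n : ℤ) n
    rw [two_mul]
    omega
  refine Runs.mono (Runs.seq <| (Runs.loop (I := CopyInv (4 * L) s.mem n) (N := n) (c := 20)
    (by simp [Expr.ConstsBounded]) (fun _ _ h => h.bounded)
    (fun i hi s' h => ⟨by simpa [Expr.eval, h.reg0, h.reg1] using hi, h.step hn hL hi⟩)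
    (fun s' h => by simp [Expr.eval, h.reg0, h.reg1])
    ⟨hb₀, fun _ _ => rfl, fun x hx => absurd hx x.not_lt_zero, h7, n.zero_le, h0, by simpa using h1,
      h3⟩).mono le_rfl
    fun s₁ h₁ => Runs.assign_seq h₁.bounded (v := 2 * n) (by simp [Expr.ConstsBounded])
      (by simp [Expr.eval, h₁.reg0]; ring) <|
      (Runs.loop (I := WalkInv (4 * L) s.mem n) (N := 2 * n) (c := n * 75 + 60)
        (by simp [Expr.ConstsBounded])
        (fun _ _ h => h.bounded)
        (fun i hi s' h => ⟨by simp [Expr.eval, h.reg2]; omega,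
          h.step (fun k _ a => hb.mem k a) hn hL hi⟩)
        (fun s' h => by simp [Expr.eval, h.reg2]) ?_).mono le_rfl fun _ h => h.mem)
    (by simp [Expr.weight, Expr.width]; ring_nf; omega) (fun _ h => h)
  have hv : ∀ x, ¬ Visited s.mem n 0 x := fun x ⟨u, _, hu, _⟩ => u.not_lt_zero hu
  exact ⟨h₁.bounded.setReg hlen, ⟨h₁.input, fun x hx => (h₁.copied x hx).1,
    fun x _ h => absurd h (hv x), fun x hx _ => ⟨(h₁.copied x hx).2, h₁.empty x⟩⟩,
    by simp [h₁.reg0], by simp, by simp [h₁.reg3]⟩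

end TNECP

/-! ### Rational instances: sizes of codes and correctness of the output -/

namespace TNECP

open RAM

section Rational

variable {n : ℕ} (M : Matrix (Fin n) (Fin n) (WithBot ℚ)) (q : Fin n → WithBot ℚ)

theorem array_coe {m : ℕ} (v : Fin m → ℤ) (i : Fin m) : array v (i : ℕ) = v i := by
  simp [array]

theorem array_flatten (A : Fin n → Fin n → ℤ) (i j : Fin n) :
    array (flatten A) (((i : ℕ) : ℤ) * n + (j : ℕ)) = A i j := by
  have h := array_coe (flatten A) (finProdFinEquiv (i, j))
  have hdm : (finProdFinEquiv (i, j)).divNat = i ∧ (finProdFinEquiv (i, j)).modNat = j :=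
    Prod.ext_iff.1 (finProdFinEquiv.symm_apply_apply (i, j))
  rw [flatten, hdm.1, hdm.2] at h
  rw [← h]
  congr 1
  simp [finProdFinEquiv]
  ring

theorem bitLen_array_le {m L : ℕ} {v : Fin m → ℤ} (hL : 1 ≤ L) (hv : ∀ i, bitLen (v i) ≤ L)
    (a : ℤ) : bitLen (array v a) ≤ L := by
  rw [array]
  split_ifs
  · exact hv _
  · simpa [bitLen] using hL

theorem codeLen_entry_le_inputSize (i j : Fin n) : codeLen (M i j) ≤ inputSize M q := by
  have h₁ := Finset.single_le_sum (f := fun j => codeLen (M i j)) (fun _ _ => Nat.zero_le _)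
    (Finset.mem_univ j)
  have h₂ := Finset.single_le_sum (f := fun i => ∑ j, codeLen (M i j)) (fun _ _ => Nat.zero_le _)
    (Finset.mem_univ i)
  simp only [inputSize] at *
  omega

theorem codeLen_vec_le_inputSize (i : Fin n) : codeLen (q i) ≤ inputSize M q := by
  have h₁ := Finset.single_le_sum (f := fun i => codeLen (q i)) (fun _ _ => Nat.zero_le _)
    (Finset.mem_univ i)
  simp only [inputSize] at *
  omega

/-- Each entry of `q` takes at least one bit. The number of rounds depends on `n` itself, so
bounding its bit length would not suffice. -/
theorem dim_le_inputSize : n ≤ inputSize M q := by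
  have h : ∑ _i : Fin n, 1 ≤ ∑ i, codeLen (q i) :=
    Finset.sum_le_sum fun i _ => (one_le_bitLen _).trans (Nat.le_add_right _ _)
  simp only [Finset.sum_const, Finset.card_univ, Fintype.card_fin, smul_eq_mul, mul_one] at h
  rw [inputSize]
  omega

theorem bitLen_dim_le_inputSize : bitLen n ≤ inputSize M q := by
  rw [inputSize]
  omega

theorem two_le_inputSize (hn : 0 < n) : 2 ≤ inputSize M q := by
  refine le_trans ?_ (bitLen_dim_le_inputSize M q)
  have : 0 < Nat.size n := Nat.size_pos.2 hn
  rw [bitLen, Int.natAbs_natCast]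
  omega

theorem bounded_input (hn : 0 < n) : (input M q).Bounded (inputSize M q) := by
  have hL := two_le_inputSize M q hn
  have hzero : bitLen 0 ≤ inputSize M q := by
    simp only [bitLen, Int.natAbs_zero, Nat.size_zero]
    omega
  constructor
  · intro x
    simp only [input]
    split_ifs
    exacts [bitLen_dim_le_inputSize M q, hzero]
  · intro k a
    match k with
    | 0 => exact bitLen_array_le (by omega) (fun i =>
        (Nat.le_add_right _ _).trans (codeLen_entry_le_inputSize M q _ _)) a
    | 1 => exact bitLen_array_le (by omega) (fun i =>
        (Nat.le_add_left _ _).trans (codeLen_entry_le_inputSize M q _ _)) a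
    | 2 => exact bitLen_array_le (by omega) (fun i =>
        (Nat.le_add_right _ _).trans (codeLen_vec_le_inputSize M q i)) a
    | 3 => exact bitLen_array_le (by omega) (fun i =>
        (Nat.le_add_left _ _).trans (codeLen_vec_le_inputSize M q i)) a
    | _ + 4 => exact hzero

theorem codeDen_nonneg (x : WithBot ℚ) : 0 ≤ codeDen x := by
  induction x using WithBot.recBotCoe <;> simp [codeDen]

theorem codeDen_pos {x : WithBot ℚ} (hx : x ≠ ⊥) : 0 < codeDen x := by
  induction x using WithBot.recBotCoe with
  | bot => exact absurd rfl hx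
  | coe r => simpa [codeDen] using r.pos

theorem slackNum_input (i j : Fin n) : slackNum (input M q).mem n j i =
    codeNum (M i j) * codeDen (q i) - codeNum (q i) * codeDen (M i j) := by
  simp only [slackNum, input, array_flatten, array_coe]

theorem slackDen_input (i j : Fin n) :
    slackDen (input M q).mem n j i = codeDen (M i j) * codeDen (q i) := by
  simp only [slackDen, input, array_flatten, array_coe]

/-- For finite `x` this is `x - y ≤ a / b` with denominators cleared, the form in which `best_spec`
gives maximality. -/
theorem add_le_iff_slack {x y : WithBot ℚ} (hy : y ≠ ⊥) {a b : ℤ} (hb : 0 < b) :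
    x + ((-(a : ℚ) / b : ℚ) : WithBot ℚ) ≤ y ↔
      x = ⊥ ∨ (codeNum x * codeDen y - codeNum y * codeDen x) * b ≤
        a * (codeDen x * codeDen y) := by
  induction x using WithBot.recBotCoe with
  | bot => simp
  | coe x =>
    induction y using WithBot.recBotCoe with
    | bot => exact absurd rfl hy
    | coe y =>
      have hb' : (0 : ℚ) < b := by exact_mod_cast hb
      have hx : (0 : ℚ) < x.den := by exact_mod_cast x.pos
      have hy : (0 : ℚ) < y.den := by exact_mod_cast y.pos
      rw [← WithBot.coe_add, WithBot.coe_le_coe, or_iff_right WithBot.coe_ne_bot]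
      simp only [codeNum, codeDen]
      rw [← Int.cast_le (R := ℚ)]
      push_cast
      have h₁ : (x.num : ℚ) = x * x.den := (Rat.mul_den_eq_num x).symm
      have h₂ : (y.num : ℚ) = y * y.den := (Rat.mul_den_eq_num y).symm
      rw [h₁, h₂, ← mul_le_mul_iff_left₀ (show (0 : ℚ) < b * x.den * y.den by positivity),
        ← sub_nonneg, ← sub_nonneg (b := (_ - _) * (b : ℚ))]
      congr! 1
      field_simp
      ring

theorem add_eq_of_slack {x y : WithBot ℚ} (hy : y ≠ ⊥)
    (hx : 0 < codeDen x * codeDen y) :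
    x + ((-((codeNum x * codeDen y - codeNum y * codeDen x : ℤ) : ℚ) /
      (codeDen x * codeDen y : ℤ) : ℚ) : WithBot ℚ) = y := by
  induction x using WithBot.recBotCoe with
  | bot => simp [codeDen] at hx
  | coe x =>
    induction y using WithBot.recBotCoe with
    | bot => exact absurd rfl hy
    | coe y =>
      rw [← WithBot.coe_add, WithBot.coe_inj]
      have hx : (0 : ℚ) < x.den := by exact_mod_cast x.pos
      have hy : (0 : ℚ) < y.den := by exact_mod_cast y.pos
      simp only [codeNum, codeDen]
      push_cast
      have h₁ : (x.num : ℚ) = x * x.den := (Rat.mul_den_eq_num x).symm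
      have h₂ : (y.num : ℚ) = y * y.den := (Rat.mul_den_eq_num y).symm
      rw [h₁, h₂]
      field_simp
      ring

theorem slackDen_input_nonneg (j : Fin n) (i : ℕ) : 0 ≤ slackDen (input M q).mem n j i := by
  by_cases hi : i < n
  · rw [show i = ((⟨i, hi⟩ : Fin n) : ℕ) from rfl, slackDen_input]
    exact mul_nonneg (codeDen_nonneg _) (codeDen_nonneg _)
  -- Rows beyond the dimension read the zeros that follow the code of `q`.
  · simp [slackDen, input, array, hi]

variable {M q} in
theorem slackNum_input_nonpos (h : IsInstance M q) (j : Fin n) (i : ℕ)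
    (hi : slackDen (input M q).mem n j i = 0) : slackNum (input M q).mem n j i ≤ 0 := by
  by_cases hin : i < n
  · rw [show i = ((⟨i, hin⟩ : Fin n) : ℕ) from rfl] at hi ⊢
    rw [slackDen_input] at hi
    rw [slackNum_input]
    have hq := codeDen_pos (h.ne_bot ⟨i, hin⟩)
    have hM : M ⟨i, hin⟩ j = ⊥ := by
      by_contra hM
      exact (mul_pos (codeDen_pos hM) hq).ne' hi
    simpa [hM, codeNum, codeDen] using hq.le
  · simp [slackNum, input, array, hin]

variable {M q} in
theorem bestSlack_input (h : IsInstance M q) (j : Fin n) :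
    0 < (bestSlack (input M q).mem n j n).2.1 ∧
    ∃ i : Fin n, (i : ℕ) = next (input M q).mem n j ∧
      (bestSlack (input M q).mem n j n).1 =
        codeNum (M i j) * codeDen (q i) - codeNum (q i) * codeDen (M i j) ∧
      (bestSlack (input M q).mem n j n).2.1 = codeDen (M i j) * codeDen (q i) := by
  have hcol : ∃ i, M i j ≠ ⊥ := by
    by_contra! hc
    exact h.col_ne_bot j (funext hc)
  obtain ⟨k, hk⟩ := hcol
  obtain ⟨h₁, h₂, h₃, h₄⟩ := best_pos (slackDen_input_nonneg M q j) (slackNum_input_nonpos h j)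
    (m := n) ⟨k, k.2, by
      rw [slackDen_input]; exact mul_pos (codeDen_pos hk) (codeDen_pos (h.ne_bot k))⟩
  refine ⟨h₁, ⟨_, h₂⟩, rfl, ?_, ?_⟩
  · rw [← slackNum_input]; exact h₃.symm
  · rw [← slackDen_input]; exact h₄.symm

variable {M q} in
theorem isSolution_of_outputInv (hn : 0 < n) (h : IsInstance M q) {s : State}
    (hs : OutputInv (input M q).mem n (2 * n) s.mem) :
    IsSolution M q (outputW n s) (outputZ n s) := by
  classical
  have hmaps : ∀ x ∈ Finset.range n, next (input M q).mem n x ∈ Finset.range n := by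
    intro x hx
    obtain ⟨-, i, hi, -⟩ := bestSlack_input h ⟨x, Finset.mem_range.1 hx⟩
    rw [Finset.mem_range, ← hi]
    exact i.2
  have hlt : ∀ x, Visited (input M q).mem n (2 * n) x → x < n := by
    rintro x ⟨u, -, -, rfl⟩
    rw [← Finset.mem_range]
    induction u with
    | zero => simpa using hn
    | succ u ih => rw [Function.iterate_succ_apply']; exact hmaps _ ih
  have hw : outputW n s =
      fun i : Fin n => if Visited (input M q).mem n (2 * n) (i : ℕ) then ⊥ else q i := by
    funext i
    rw [outputW]
    split_ifs with hi
    -- A zero denominator alone denotes `-∞`; the stale numerator in bank `4` does no harm.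
    · rw [(hs.visited i i.2 hi).1, decode, if_pos rfl]
    · rw [(hs.unvisited i i.2 hi).1, hs.wNum i i.2]
      simp only [input, array_coe]
      exact decode_code _
  have hz : outputZ n s = fun j : Fin n => if Visited (input M q).mem n (2 * n) (j : ℕ) then
      ((-((bestSlack (input M q).mem n j n).1 : ℚ) / (bestSlack (input M q).mem n j n).2.1 : ℚ) :
        WithBot ℚ) else ⊥ := by
    funext j
    rw [outputZ]
    split_ifs with hj
    · rw [(hs.visited j j.2 hj).2.1, (hs.visited j j.2 hj).2.2, decode,
        if_neg (bestSlack_input h j).1.ne', Int.cast_neg]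
    · rw [(hs.unvisited j j.2 hj).2, decode, if_pos rfl]
  rw [hw, hz]
  refine isSolution_of_support (fun i : Fin n => Visited (input M q).mem n (2 * n) (i : ℕ)) _
    (fun j _ i => ?_) (fun i hi => ?_) ⟨⟨_, hlt _ ⟨n, le_rfl, by omega, rfl⟩⟩, n, le_rfl, by omega, rfl⟩
  · rw [add_le_iff_slack (h.ne_bot i) (bestSlack_input h j).1, ← slackNum_input, ← slackDen_input]
    exact .inr ((best_spec (slackDen_input_nonneg M q j) (slackNum_input_nonpos h j) n).1 i i.2)
  -- The walk lives on `ℕ`; `next` preserves `Finset.range n`, which has `n` elements, so the window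
  -- still yields a predecessor.
  · obtain ⟨y, hy, hyi⟩ := exists_iterate_predecessor hmaps (Finset.mem_range.2 hn) (by simp) hi
    obtain ⟨hpos, k, hk, hnum, hden⟩ := bestSlack_input h ⟨y, hlt y hy⟩
    obtain rfl : k = i := Fin.ext (hk.trans hyi)
    refine ⟨⟨y, hlt y hy⟩, hy, ?_⟩
    rw [hden] at hpos
    rw [hnum, hden]
    exact add_eq_of_slack (h.ne_bot k) hpos

end Rational

end TNECP

open Polynomial in
theorem theorem2 :
    (∀ n : ℕ, 0 < n → ∀ (M : Matrix (Fin n) (Fin n) (WithBot ℝ)) (q : Fin n → WithBot ℝ),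
      TNECP.IsInstance M q → ∃ w z : Fin n → WithBot ℝ, TNECP.IsSolution M q w z) ∧
    ∃ (P : RAM.Prog) (p : Polynomial ℕ), ∀ n : ℕ, 0 < n →
      ∀ (M : Matrix (Fin n) (Fin n) (WithBot ℚ)) (q : Fin n → WithBot ℚ),
        TNECP.IsInstance M q →
          ∃ (s : RAM.State) (t : ℕ),
            RAM.Exec P (TNECP.input M q) s t ∧
            t ≤ p.eval (TNECP.inputSize M q) ∧
            TNECP.IsSolution M q (TNECP.outputW n s) (TNECP.outputZ n s) := by
  refine ⟨fun n hn M q h => TNECP.exists_isSolution hn h, TNECP.solver,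
    -- The bound of `runs_solver` with both `n` and `L` replaced by the input size.
    (X * 25 + 2 * X * (X * 75 + 62) + 20) * (4 * X), fun n hn M q h => ?_⟩
  obtain ⟨s, t, hexec, ht, hs⟩ := TNECP.runs_solver (TNECP.bounded_input M q hn)
    (TNECP.two_le_inputSize M q hn) rfl rfl rfl fun _ => rfl
  refine ⟨s, t, hexec, ht.trans ?_, TNECP.isSolution_of_outputInv hn h hs⟩
  have hle := TNECP.dim_le_inputSize M q
  simp only [eval_mul, eval_add, eval_X, eval_ofNat]
  gcongr
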